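/- For $n\ge 0$, a function $f:\{0,1\}^n\to\mathbb R$ is called XOS if there is a finite nonempty set $C\subset[0,\infty)^n$ such that $f(x)=\max_{w\in C}\sum_{i=1}^n w_i x_i$ for all $x\in\{0,1\}^n$. Let $\|g\|_2=\bigl(2^{-n}\sum_{x\in\{0,1\}^n} g(x)^2\bigr)^{1/2}$, and for $\epsilon>0$ let $\deg^{\ell_2}_\epsilon(f)$, the $(\ell_2,\epsilon)$-approximate degree of $f$, be the smallest $d$ such that there is a real polynomial $p$ in $n$ variables of degree at most $d$ with $\|f-p\|_2\le\epsilon$. **Theorem.** There are absolute constants $a,b,c>0$ such that for every $0<\epsilon<\tfrac12$ there exist an integer $k$ with $a/\epsilon^2\le k\le b/\epsilon^2$ and an XOS function $f:\{0,1\}^k\to[0,1]$ with $\deg^{\ell_2}_\epsilon(f)\ge c/\epsilon$. (In short: $k=\Theta(1/\epsilon^2)$ and $\deg^{\ell_2}_\epsilon(f)=\Omega(1/\epsilon)$.) -/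

import Mathlib

namespace BooleanCube

/-- The `0/1` real vector of a point of the cube `{0,1}^n`. -/
def toReal {n : ℕ} (x : Fin n → Bool) : Fin n → ℝ :=
  fun i => if x i = true then 1 else 0

/-- `f` is XOS: a maximum of finitely many linear functions `x ↦ ∑ i, w i * x i`
with nonnegative weights (the clauses). `IsGreatest` forces the set `C` of clauses to be
nonempty. -/
def IsXOS {n : ℕ} (f : (Fin n → Bool) → ℝ) : Prop :=
  ∃ C : Finset (Fin n → ℝ), (∀ w ∈ C, ∀ i, 0 ≤ w i) ∧
    ∀ x, IsGreatest ((fun w : Fin n → ℝ => ∑ i, w i * toReal x i) '' (C : Set (Fin n → ℝ))) (f x)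

/-- The `ℓ₂` norm with respect to the uniform distribution on `{0,1}^n`. -/
noncomputable def l2Norm {n : ℕ} (g : (Fin n → Bool) → ℝ) : ℝ :=
  Real.sqrt ((∑ x, g x ^ 2) / 2 ^ n)

/-- The `(ℓ₂, ε)`-approximate degree of `f`: the smallest `d` such that some real polynomial `p`
of degree at most `d` satisfies `‖f - p‖₂ ≤ ε`. -/
noncomputable def approxDegree {n : ℕ} (ε : ℝ) (f : (Fin n → Bool) → ℝ) : ℕ :=
  sInf {d : ℕ | ∃ p : MvPolynomial (Fin n) ℝ, p.totalDegree ≤ d ∧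
    l2Norm (fun x => f x - MvPolynomial.eval (toReal x) p) ≤ ε}

end BooleanCube

/-! Let m be of order 1/ε and use m² variables. A random DNF of 2^m/256 terms of width m (a
Talagrand-type DNF) yields an XOS function f that is 1 on accepted points and exactly 1 - 1/m on the
others, the origin excepted (`exists_isXOS_of_terms`).

Split the variables into m blocks of size m. Near the middle layer a random term accepts with
probability of order 2^(-m). Since a block flip is as large as the standard deviation scale m of the
weight, a constant fraction of the terms satisfied at one endpoint fails at the other. So the flip
changes the DNF with constant probability, and averaging fixes one good DNF
(`exists_sensitive_terms`). The mean squared change of f, summed over blocks, is then of order m ·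
1/m².

A Walsh character on S sees at most #S disjoint blocks, so degree d bounds this energy by 4d times
the second moment (`sum_sq_sub_flipOn_le`). After subtracting 1 - 1/m, an approximant has second
moment O(1/m²), which forces d = Ω(m) (`le_totalDegree_of_sensitive`). For ε bounded below, one
coordinate suffices. -/

namespace BooleanCube

open Finset

/-! ### Fourier analysis on the cube -/

/-- Flip the coordinates of `x` that lie in `B`. -/
def flipOn {n : ℕ} (B : Finset (Fin n)) (x : Fin n → Bool) : Fin n → Bool :=
  fun i => if i ∈ B then !x i else x i

lemma flipOn_involutive {n : ℕ} (B : Finset (Fin n)) : Function.Involutive (flipOn B) := by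
  intro x
  funext i
  by_cases h : i ∈ B <;> simp [flipOn, h]

lemma sum_flipOn {n : ℕ} (B : Finset (Fin n)) (F : (Fin n → Bool) → ℝ) :
    ∑ x, F (flipOn B x) = ∑ x, F x :=
  Equiv.sum_comp (flipOn_involutive B).toPerm F

/-- The sign `(-1)^b` of a bit. -/
def bitSign (b : Bool) : ℝ := if b = true then -1 else 1

/-- The Walsh character `x ↦ ∏ i ∈ S, (-1)^(x i)`. -/
def walsh {n : ℕ} (S : Finset (Fin n)) (x : Fin n → Bool) : ℝ := ∏ i ∈ S, bitSign (x i)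

lemma walsh_flipOn {n : ℕ} (S B : Finset (Fin n)) (x : Fin n → Bool) :
    walsh S (flipOn B x) = (-1) ^ #(S ∩ B) * walsh S x := by
  have h : ∀ i, bitSign (flipOn B x i) = (if i ∈ B then -1 else 1) * bitSign (x i) := by
    intro i
    by_cases h : i ∈ B <;> cases hx : x i <;> simp [flipOn, h, bitSign, hx]
  simp only [walsh, h, prod_mul_distrib, prod_ite, prod_const, one_pow, mul_one,
    filter_mem_eq_inter]

lemma sum_walsh_mul_walsh {n : ℕ} (x y : Fin n → Bool) :
    ∑ S, walsh S x * walsh S y = if x = y then (2 : ℝ) ^ n else 0 := by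
  have h : ∑ S, walsh S x * walsh S y = ∏ i, (1 + bitSign (x i) * bitSign (y i)) := by
    simp only [walsh, ← prod_mul_distrib]
    rw [prod_one_add, powerset_univ]
  rw [h]
  split_ifs with hxy
  · subst hxy
    rw [prod_congr rfl (g := fun _ => (2 : ℝ))]
    · simp
    · intro i _
      cases x i <;> norm_num [bitSign]
  · obtain ⟨i, hi⟩ := Function.ne_iff.mp hxy
    refine prod_eq_zero (mem_univ i) ?_
    cases hx : x i <;> cases hy : y i <;> simp_all [bitSign]

lemma parseval {n : ℕ} (F : (Fin n → Bool) → ℝ) :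
    ∑ S, (∑ x, F x * walsh S x) ^ 2 = 2 ^ n * ∑ x, F x ^ 2 := by
  calc ∑ S, (∑ x, F x * walsh S x) ^ 2
      = ∑ S, ∑ x, ∑ y, F x * F y * (walsh S x * walsh S y) := by
        refine sum_congr rfl fun S _ => ?_
        rw [sq, sum_mul_sum]
        exact sum_congr rfl fun x _ => sum_congr rfl fun y _ => by ring
    _ = ∑ x, ∑ y, F x * F y * ∑ S, walsh S x * walsh S y := by
        rw [sum_comm]
        refine sum_congr rfl fun x _ => ?_
        rw [sum_comm]
        exact sum_congr rfl fun y _ => by rw [mul_sum]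
    _ = 2 ^ n * ∑ x, F x ^ 2 := by
        simp only [sum_walsh_mul_walsh, mul_ite, mul_zero, sum_ite_eq, mem_univ, if_true, mul_sum]
        exact sum_congr rfl fun x _ => by ring

/-- Flipping coordinate `i` pairs points whose contributions cancel. -/
lemma sum_mul_walsh_eq_zero {n : ℕ} (F : (Fin n → Bool) → ℝ) (S : Finset (Fin n)) (i : Fin n)
    (hi : i ∈ S) (hF : ∀ x, F (flipOn {i} x) = F x) : ∑ x, F x * walsh S x = 0 := by
  have h := sum_flipOn {i} fun x => F x * walsh S x
  simp only [hF, walsh_flipOn, inter_singleton_of_mem hi, card_singleton, pow_one] at h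
  have h2 : ∑ x, F x * (-1 * walsh S x) = -∑ x, F x * walsh S x := by
    rw [← sum_neg_distrib]
    exact sum_congr rfl fun x _ => by ring
  linarith

/-- Each monomial, multilinear or not, misses some variable of `S`, so it is orthogonal to the
character. -/
lemma sum_eval_mul_walsh_eq_zero {n : ℕ} (p : MvPolynomial (Fin n) ℝ) (S : Finset (Fin n))
    (hS : p.totalDegree < #S) : ∑ x, MvPolynomial.eval (toReal x) p * walsh S x = 0 := by
  simp only [MvPolynomial.eval_eq, sum_mul]
  rw [sum_comm]
  refine sum_eq_zero fun e he => ?_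
  have hcard : #e.support < #S := by
    refine lt_of_le_of_lt ?_ (lt_of_le_of_lt (MvPolynomial.le_totalDegree he) hS)
    rw [Finsupp.sum, card_eq_sum_ones]
    refine sum_le_sum fun i hi => ?_
    have := Finsupp.mem_support_iff.mp hi
    omega
  obtain ⟨i, hiS, hie⟩ := exists_mem_notMem_of_card_lt_card hcard
  refine sum_mul_walsh_eq_zero (fun x => MvPolynomial.coeff e p * ∏ l ∈ e.support, toReal x l ^ e l)
    S i hiS fun x => ?_
  congr 1
  refine prod_congr rfl fun l hl => ?_
  have : l ≠ i := fun h => hie (h ▸ hl)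
  simp [toReal, flipOn, this]

/-! ### Block-flip energy of low-degree polynomials -/

/-- The fibre of `β` over `j`. -/
def block {n m : ℕ} (β : Fin n → Fin m) (j : Fin m) : Finset (Fin n) := univ.filter fun i => β i = j

/-- A polynomial of degree `d` has block-flip energy at most `4 d` times its second moment. -/
lemma sum_sq_sub_flipOn_le {n m : ℕ} (β : Fin n → Fin m) (p : MvPolynomial (Fin n) ℝ) :
    ∑ j, ∑ x, (MvPolynomial.eval (toReal x) p -
        MvPolynomial.eval (toReal (flipOn (block β j) x)) p) ^ 2 ≤
      4 * p.totalDegree * ∑ x : Fin n → Bool, MvPolynomial.eval (toReal x) p ^ 2 := by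
  set P : (Fin n → Bool) → ℝ := fun x => MvPolynomial.eval (toReal x) p with hP
  have hcoef : ∀ j S, ∑ x, (P x - P (flipOn (block β j) x)) * walsh S x =
      (1 - (-1) ^ #(S ∩ block β j)) * ∑ x, P x * walsh S x := by
    intro j S
    have h := sum_flipOn (block β j) fun x => P (flipOn (block β j) x) * walsh S x
    simp only [flipOn_involutive (block β j) _, walsh_flipOn] at h
    simp only [sub_mul, sum_sub_distrib, one_mul]
    rw [← h, mul_sum]
    congr 1
    exact sum_congr rfl fun x _ => by ring
  -- A summand is 4 if the block meets `S` in an odd number of points and 0 otherwise; the blocks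
  -- partition `S`.
  have hfac : ∀ (S : Finset (Fin n)),
      ∑ j, (1 - (-1 : ℝ) ^ #(S ∩ block β j)) ^ 2 ≤ 4 * (#S : ℝ) := by
    intro S
    calc ∑ j, (1 - (-1 : ℝ) ^ #(S ∩ block β j)) ^ 2
        ≤ ∑ j, 4 * (#(S ∩ block β j) : ℝ) := by
          refine sum_le_sum fun j _ => ?_
          rcases Nat.eq_zero_or_pos #(S ∩ block β j) with h | h
          · simp [h]
          · have h1 : (1 : ℝ) ≤ #(S ∩ block β j) := by exact_mod_cast h
            rcases neg_one_pow_eq_or ℝ #(S ∩ block β j) with h2 | h2 <;> rw [h2] <;> linarith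
      _ = 4 * (#S : ℝ) := by
          rw [← mul_sum, card_eq_sum_card_fiberwise (f := β) (t := univ) fun _ _ => by simp]
          push_cast
          congr 1
          refine sum_congr rfl fun j _ => ?_
          congr 2
          ext i
          simp [block]
  have hpos : (0 : ℝ) < 2 ^ n := by positivity
  refine le_of_mul_le_mul_left ?_ hpos
  calc (2 : ℝ) ^ n * ∑ j, ∑ x, (P x - P (flipOn (block β j) x)) ^ 2
      = ∑ S, (∑ j, (1 - (-1 : ℝ) ^ #(S ∩ block β j)) ^ 2) * (∑ x, P x * walsh S x) ^ 2 := by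
        rw [mul_sum]
        simp only [← parseval, hcoef, mul_pow, sum_mul]
        rw [sum_comm]
    _ ≤ ∑ S, 4 * p.totalDegree * (∑ x, P x * walsh S x) ^ 2 := by
        refine sum_le_sum fun S _ => ?_
        rcases lt_or_ge p.totalDegree #S with h | h
        · rw [hP, sum_eval_mul_walsh_eq_zero p S h]
          simp
        · refine mul_le_mul_of_nonneg_right ((hfac S).trans ?_) (sq_nonneg _)
          have : (#S : ℝ) ≤ p.totalDegree := by exact_mod_cast h
          linarith
    _ = 2 ^ n * (4 * p.totalDegree * ∑ x, P x ^ 2) := by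
        rw [← mul_sum, parseval]
        ring

/-- Every real function on the cube is given by a polynomial. -/
lemma exists_eval_eq {n : ℕ} (f : (Fin n → Bool) → ℝ) :
    ∃ p : MvPolynomial (Fin n) ℝ, ∀ x, MvPolynomial.eval (toReal x) p = f x := by
  refine ⟨∑ a, MvPolynomial.C (f a) * ∏ i, (if a i = true then MvPolynomial.X i
    else 1 - MvPolynomial.X i), fun x => ?_⟩
  simp only [map_sum, map_mul, MvPolynomial.eval_C, map_prod]
  rw [sum_eq_single x]
  · rw [prod_eq_one, mul_one]
    intro i _
    cases h : x i <;> simp [toReal, h]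
  · intro a _ hax
    obtain ⟨i, hi⟩ := Function.ne_iff.mp hax
    rw [prod_eq_zero (mem_univ i), mul_zero]
    cases h : x i <;> cases h2 : a i <;> simp_all [toReal]
  · simp

/-! ### Variance of the weight and counting of random terms -/

/-- The number of ones of `x`. -/
def weight {n : ℕ} (x : Fin n → Bool) : ℕ := #(univ.filter fun i => x i = true)

lemma sum_weight_sub_sq {n : ℕ} :
    ∑ x : Fin n → Bool, ((weight x : ℝ) - (n : ℝ) / 2) ^ 2 = 2 ^ n * ((n : ℝ) / 4) := by
  have hw : ∀ x : Fin n → Bool, (weight x : ℝ) - (n : ℝ) / 2 = -(1 / 2) * ∑ i, bitSign (x i) := by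
    intro x
    have h1 : ∀ i, bitSign (x i) = 1 - 2 * (if x i = true then (1 : ℝ) else 0) := by
      intro i
      cases x i <;> norm_num [bitSign]
    simp only [h1, sum_sub_distrib, ← mul_sum, sum_boole, weight]
    simp
    ring
  have hortho : ∀ i j : Fin n, ∑ x : Fin n → Bool, bitSign (x i) * bitSign (x j) =
      if i = j then (2 : ℝ) ^ n else 0 := by
    intro i j
    split_ifs with hij
    · subst hij
      rw [sum_congr rfl (g := fun _ => (1 : ℝ))]
      · simp
      · intro x _
        cases x i <;> norm_num [bitSign]
    · have := sum_mul_walsh_eq_zero (fun x : Fin n → Bool => bitSign (x j)) {i} i (by simp)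
        (fun x => by simp [flipOn, Ne.symm hij])
      rw [← this]
      exact sum_congr rfl fun x _ => by simp [walsh, mul_comm]
  calc ∑ x : Fin n → Bool, ((weight x : ℝ) - (n : ℝ) / 2) ^ 2
      = 1 / 4 * ∑ x : Fin n → Bool, ∑ i, ∑ j, bitSign (x i) * bitSign (x j) := by
        rw [mul_sum]
        refine sum_congr rfl fun x _ => ?_
        rw [hw, ← sum_mul_sum]
        ring
    _ = 1 / 4 * ∑ i : Fin n, ∑ j : Fin n, if i = j then (2 : ℝ) ^ n else 0 := by
        rw [sum_comm]
        congr 1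
        refine sum_congr rfl fun i _ => ?_
        rw [sum_comm]
        exact sum_congr rfl fun j _ => hortho i j
    _ = 2 ^ n * ((n : ℝ) / 4) := by
        simp
        ring

lemma card_forall_mem {α : Type*} [Fintype α] [DecidableEq α] (N : ℕ) (A : Finset α) :
    #(univ.filter fun T : Fin N → α => ∀ t, T t ∈ A) = #A ^ N := by
  have h : (univ.filter fun T : Fin N → α => ∀ t, T t ∈ A) = Fintype.piFinset fun _ => A := by
    ext T
    simp
  rw [h, Fintype.card_piFinset_const]

/-- Here `v` is the chance that a random term avoids both sets and `b` the chance that it lies in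
the first only. Bernoulli's inequality is used twice. -/
lemma mul_pow_le_add_pow_sub_pow {v b : ℝ} (N : ℕ) (hv : 0 ≤ v) (hv1 : v ≤ 1) (hb : 0 ≤ b)
    (hN : N * (1 - v) ≤ 1 / 2) : N * b / 2 ≤ (v + b) ^ N - v ^ N := by
  have h1 : 1 / 2 ≤ v ^ N := by
    have := one_add_mul_le_pow (a := -(1 - v)) (by linarith) N
    rw [show 1 + -(1 - v) = v by ring] at this
    linarith
  have h2 : v ^ N * (1 + N * b) ≤ (v + b) ^ N := by
    calc v ^ N * (1 + N * b) ≤ v ^ N * (1 + b) ^ N :=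
          mul_le_mul_of_nonneg_left (one_add_mul_le_pow (by linarith) N) (by positivity)
      _ = (v * (1 + b)) ^ N := (mul_pow _ _ _).symm
      _ ≤ (v + b) ^ N := pow_le_pow_left₀ (by positivity) (by nlinarith) N
  have h3 : 0 ≤ N * b := by positivity
  nlinarith

/-- A lower bound for the number of `N`-tuples that hit `X` but avoid `Y`. -/
lemma card_hit_avoid_ge {α : Type*} [Fintype α] [DecidableEq α] [Nonempty α] (N : ℕ)
    (X Y : Finset α) (h : (N : ℝ) * (#(X ∪ Y) / Fintype.card α) ≤ 1 / 2) :
    (N : ℝ) * (#(X \ Y) / Fintype.card α) / 2 * Fintype.card (Fin N → α) ≤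
      #(univ.filter fun T : Fin N → α => (∃ t, T t ∈ X) ∧ ¬ ∃ t, T t ∈ Y) := by
  have hK : (0 : ℝ) < Fintype.card α := by exact_mod_cast Fintype.card_pos
  -- The event is a difference of two nested product events, whose sizes are exact powers.
  have hsplit : (univ.filter fun T : Fin N → α => (∃ t, T t ∈ X) ∧ ¬ ∃ t, T t ∈ Y) =
      (univ.filter fun T : Fin N → α => ∀ t, T t ∈ Yᶜ) \
        (univ.filter fun T : Fin N → α => ∀ t, T t ∈ (X ∪ Y)ᶜ) := by
    ext T
    simp only [mem_filter, mem_sdiff, mem_univ, true_and, mem_compl, mem_union, not_exists]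
    constructor
    · rintro ⟨⟨t, ht⟩, hY⟩
      exact ⟨hY, fun hall => hall t (Or.inl ht)⟩
    · rintro ⟨hY, hX⟩
      push Not at hX
      obtain ⟨t, ht⟩ := hX
      exact ⟨⟨t, ht.resolve_right (hY t)⟩, hY⟩
  have hsub : (univ.filter fun T : Fin N → α => ∀ t, T t ∈ (X ∪ Y)ᶜ) ⊆
      (univ.filter fun T : Fin N → α => ∀ t, T t ∈ Yᶜ) := by
    intro T
    simp only [mem_filter, mem_univ, true_and, mem_compl, mem_union]
    exact fun hT t ht => hT t (Or.inr ht)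
  rw [hsplit, cast_card_sdiff hsub, card_forall_mem, card_forall_mem]
  have hU : (#(X ∪ Y) : ℝ) = #(X \ Y) + #Y := by
    rw [← sdiff_union_self_eq_union, card_union_of_disjoint sdiff_disjoint]
    push_cast
    rfl
  have hc : ∀ A : Finset α, (#Aᶜ : ℝ) = Fintype.card α * (1 - #A / Fintype.card α) := by
    intro A
    rw [card_compl, Nat.cast_sub (card_le_univ A)]
    field_simp
  have hle : (#(X ∪ Y) : ℝ) / Fintype.card α ≤ 1 := by
    rw [div_le_one hK]
    exact_mod_cast card_le_univ _
  have key := mul_pow_le_add_pow_sub_pow (v := 1 - #(X ∪ Y) / Fintype.card α)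
    (b := #(X \ Y) / Fintype.card α) N (by linarith)
    (by have : (0 : ℝ) ≤ #(X ∪ Y) / Fintype.card α := by positivity
        linarith) (by positivity) (by linarith)
  have hv : (1 : ℝ) - #(X ∪ Y) / Fintype.card α + #(X \ Y) / Fintype.card α =
      1 - #Y / Fintype.card α := by
    rw [hU]
    ring
  rw [hv] at key
  push_cast
  rw [hc, hc, mul_pow, mul_pow, ← mul_sub, Fintype.card_fun, Fintype.card_fin, Nat.cast_pow,
    mul_comm]
  exact mul_le_mul_of_nonneg_left key (by positivity)

/-- `x` satisfies one of the terms `T t`, each being a conjunction of `m` variables. -/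
def Accepts {n m N : ℕ} (T : Fin N → Fin m → Fin n) (x : Fin n → Bool) : Prop :=
  ∃ t, ∀ i, x (T t i) = true

lemma card_satisfying {n : ℕ} (m : ℕ) (x : Fin n → Bool) :
    #(univ.filter fun h : Fin m → Fin n => ∀ i, x (h i) = true) = weight x ^ m := by
  rw [weight, ← card_forall_mem]
  simp

/-! ### Term probabilities near the middle layer -/

section Estimates

variable {m w z : ℕ}

/-- The ratio is at most 2^(-m) (1 + 4/m)^m, and e^4 ≤ 64. -/
lemma pow_div_le_exp (hm : 8 ≤ m) (hw : (w : ℝ) ≤ m ^ 2 / 2 + 2 * m) :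
    (w : ℝ) ^ m / (m ^ 2) ^ m ≤ 64 / 2 ^ m := by
  have hm0 : (0 : ℝ) < m := by positivity
  have h1 : (w : ℝ) ≤ m ^ 2 / 2 * Real.exp (4 / m) := by
    have := Real.add_one_le_exp (4 / (m : ℝ))
    calc (w : ℝ) ≤ m ^ 2 / 2 * (4 / m + 1) := by
          refine hw.trans (le_of_eq ?_)
          field_simp
          ring
      _ ≤ _ := mul_le_mul_of_nonneg_left this (by positivity)
  have h2 : Real.exp (4 / m) ^ m ≤ 64 := by
    rw [← Real.exp_nat_mul, mul_div_cancel₀ _ hm0.ne', show (4 : ℝ) = (4 : ℕ) * 1 by norm_num,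
      Real.exp_nat_mul]
    calc Real.exp 1 ^ 4 ≤ 2.75 ^ 4 :=
          pow_le_pow_left₀ (Real.exp_pos 1).le (Real.exp_one_lt_d9.le.trans (by norm_num)) 4
      _ ≤ 64 := by norm_num
  rw [div_le_div_iff₀ (by positivity) (by positivity)]
  calc (w : ℝ) ^ m * 2 ^ m ≤ (m ^ 2 / 2 * Real.exp (4 / m)) ^ m * 2 ^ m := by gcongr
    _ = (m ^ 2) ^ m * Real.exp (4 / m) ^ m := by
        rw [mul_pow, div_pow]
        field_simp
    _ ≤ 64 * (m ^ 2) ^ m := by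
        rw [mul_comm]
        gcongr

/-- The ratio is at least 2^(-m) (1 - 4/m)^m, and 1 - 4/m ≥ e^(-8/m) once m ≥ 8. -/
lemma exp_le_pow_div (hm : 8 ≤ m) (hw : (m : ℝ) ^ 2 / 2 - 2 * m ≤ w) :
    Real.exp (-8) / 2 ^ m ≤ (w : ℝ) ^ m / (m ^ 2) ^ m := by
  have hm8 : (8 : ℝ) ≤ m := by exact_mod_cast hm
  have hm0 : (0 : ℝ) < m := by linarith
  have h1 : (m : ℝ) ^ 2 / 2 * Real.exp (-8 / m) ≤ w := by
    refine le_trans ?_ hw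
    have h2 : Real.exp (-8 / m) ≤ 1 - 4 / m := by
      rw [neg_div, Real.exp_neg, inv_le_comm₀ (Real.exp_pos _)
        (by rw [sub_pos, div_lt_one hm0]; linarith)]
      refine le_trans ?_ (Real.add_one_le_exp (8 / (m : ℝ)))
      rw [inv_le_iff_one_le_mul₀ (by rw [sub_pos, div_lt_one hm0]; linarith)]
      rw [show (8 / (m : ℝ) + 1) * (1 - 4 / m) = 1 + 4 * (m - 8) / m ^ 2 by field_simp; ring]
      have : 0 ≤ 4 * ((m : ℝ) - 8) / m ^ 2 := div_nonneg (by linarith) (by positivity)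
      linarith
    calc (m : ℝ) ^ 2 / 2 * Real.exp (-8 / m) ≤ (m : ℝ) ^ 2 / 2 * (1 - 4 / m) := by gcongr
      _ = (m : ℝ) ^ 2 / 2 - 2 * m := by field_simp; ring
  rw [div_le_div_iff₀ (by positivity) (by positivity)]
  calc Real.exp (-8) * (m ^ 2) ^ m = (m ^ 2 / 2 * Real.exp (-8 / m)) ^ m * 2 ^ m := by
        rw [mul_pow, div_pow, ← Real.exp_nat_mul, mul_div_cancel₀ _ hm0.ne']
        field_simp
    _ ≤ (w : ℝ) ^ m * 2 ^ m := by gcongr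

/-- As `w` ≤ m², losing m/2 ones is a relative loss of at least 1/(2m); the m-th power turns this
into e^(-1/2) ≤ 2/3. -/
lemma pow_le_two_thirds_mul_pow (hm : 8 ≤ m) (hw : (w : ℝ) ≤ m ^ 2 / 2 + 2 * m)
    (hz : (z : ℝ) + m / 2 ≤ w) : (z : ℝ) ^ m ≤ 2 / 3 * (w : ℝ) ^ m := by
  have hm8 : (8 : ℝ) ≤ m := by exact_mod_cast hm
  have hm0 : (0 : ℝ) < m := by linarith
  have h1 : (z : ℝ) ≤ w * Real.exp (-(1 / 2) / m) := by
    have h2 := Real.add_one_le_exp (-(1 / 2) / (m : ℝ))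
    calc (z : ℝ) ≤ w * (-(1 / 2) / m + 1) := by
          have h3 : (w : ℝ) / m ≤ m := by
            rw [div_le_iff₀ hm0]
            nlinarith
          rw [show (w : ℝ) * (-(1 / 2) / m + 1) = w - w / m / 2 by ring]
          linarith
      _ ≤ _ := by gcongr
  have h4 : Real.exp (-(1 / 2)) ≤ 2 / 3 := by
    rw [Real.exp_neg, inv_le_comm₀ (Real.exp_pos _) (by norm_num)]
    have := Real.add_one_le_exp (1 / 2 : ℝ)
    norm_num at this ⊢
    linarith
  calc (z : ℝ) ^ m ≤ (w * Real.exp (-(1 / 2) / m)) ^ m := by gcongr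
    _ = Real.exp (-(1 / 2)) * (w : ℝ) ^ m := by
        rw [mul_pow, ← Real.exp_nat_mul, mul_div_cancel₀ _ hm0.ne', mul_comm]
    _ ≤ 2 / 3 * (w : ℝ) ^ m := by gcongr

end Estimates

/-! ### Block sensitivity of a random DNF -/

open Classical in
/-- If `x` has sufficiently many ones that `y` lacks, a constant fraction of the families of
terms accept `x` and reject `y`. -/
lemma card_accepts_not_accepts_ge {m N : ℕ} (hm : 8 ≤ m) (hN : N * 256 = 2 ^ m)
    (x y : Fin (m * m) → Bool)
    (hx : (weight x : ℝ) ≤ m ^ 2 / 2 + 2 * m) (hx' : (m : ℝ) ^ 2 / 2 - 2 * m ≤ weight x)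
    (hy : (weight y : ℝ) ≤ m ^ 2 / 2 + 2 * m)
    (hxy : (weight (fun i => x i && y i) : ℝ) + m / 2 ≤ weight x) :
    Real.exp (-8) / 1536 * Fintype.card (Fin N → Fin m → Fin (m * m)) ≤
      #(univ.filter fun T : Fin N → Fin m → Fin (m * m) => Accepts T x ∧ ¬ Accepts T y) := by
  set X : Finset (Fin m → Fin (m * m)) := univ.filter fun h => ∀ i, x (h i) = true with hX
  set Y : Finset (Fin m → Fin (m * m)) := univ.filter fun h => ∀ i, y (h i) = true with hY
  have hmm : 0 < m * m := by positivity
  have : Nonempty (Fin (m * m)) := ⟨⟨0, hmm⟩⟩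
  have hN' : (N : ℝ) = 2 ^ m / 256 := by
    have : (N : ℝ) * 256 = 2 ^ m := by exact_mod_cast hN
    linarith
  have hcard : (Fintype.card (Fin m → Fin (m * m)) : ℝ) = (m ^ 2) ^ m := by
    simp [sq]
  have hXc : (#X : ℝ) = (weight x : ℝ) ^ m := by
    rw [hX, card_satisfying]; push_cast; rfl
  have hYc : (#Y : ℝ) = (weight y : ℝ) ^ m := by
    rw [hY, card_satisfying]; push_cast; rfl
  have hXY : (#(X ∩ Y) : ℝ) = (weight (fun i => x i && y i) : ℝ) ^ m := by
    rw [← Nat.cast_pow, ← card_satisfying, hX, hY, ← filter_and]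
    simp [forall_and]
  have hD : (#(X \ Y) : ℝ) = #X - #(X ∩ Y) := by
    have := card_sdiff_add_card_inter X Y
    rw [← this]
    push_cast
    ring
  have hU : (#(X ∪ Y) : ℝ) ≤ #X + #Y := by exact_mod_cast card_union_le X Y
  -- The 256 in `hN` makes the expected number of terms satisfied by `x` or `y` at most 2 · 64/256 =
  -- 1/2.
  have key := card_hit_avoid_ge N X Y (by
    rw [hcard]
    calc (N : ℝ) * (#(X ∪ Y) / ((m : ℝ) ^ 2) ^ m)
        ≤ (N : ℝ) * (#X / ((m : ℝ) ^ 2) ^ m + #Y / ((m : ℝ) ^ 2) ^ m) := by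
          rw [← add_div]
          gcongr
      _ ≤ (N : ℝ) * (64 / 2 ^ m + 64 / 2 ^ m) := by
          rw [hXc, hYc]
          exact mul_le_mul_of_nonneg_left
            (add_le_add (pow_div_le_exp hm hx) (pow_div_le_exp hm hy)) (Nat.cast_nonneg N)
      _ = 1 / 2 := by
          rw [hN']
          field_simp
          norm_num)
  have hmem : ∀ T : Fin N → Fin m → Fin (m * m),
      (Accepts T x ∧ ¬ Accepts T y) ↔ ((∃ t, T t ∈ X) ∧ ¬ ∃ t, T t ∈ Y) := by
    intro T
    simp [Accepts, hX, hY]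
  rw [filter_congr fun T _ => hmem T]
  refine le_trans (mul_le_mul_of_nonneg_right ?_ (Nat.cast_nonneg _)) key
  rw [hcard, hD, hXY, hXc, hN']
  have h1 := exp_le_pow_div hm hx'
  have h2 := pow_le_two_thirds_mul_pow hm hx hxy
  -- 1536 = 256 · 3 · 2: number of terms, fraction 1/3 lost between `x` and `y`, and the 1/2 from
  -- `card_hit_avoid_ge`.
  calc Real.exp (-8) / 1536 = 2 ^ m / 256 * (1 / 3 * (Real.exp (-8) / 2 ^ m)) / 2 := by
        field_simp
        norm_num
    _ ≤ 2 ^ m / 256 * (1 / 3 * ((weight x : ℝ) ^ m / (m ^ 2) ^ m)) / 2 := by gcongr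
    _ = 2 ^ m / 256 * (1 / 3 * (weight x : ℝ) ^ m / (m ^ 2) ^ m) / 2 := by ring
    _ ≤ _ := by
        gcongr
        linarith

lemma weight_eq_add {n : ℕ} (B : Finset (Fin n)) (x : Fin n → Bool) :
    weight x = weight (fun i => x i && flipOn B x i) + #(B.filter fun i => x i = true) := by
  rw [weight, weight, ← card_union_of_disjoint]
  · congr 1
    ext i
    by_cases h : i ∈ B <;> cases hx : x i <;> simp [flipOn, h, hx]
  · rw [disjoint_left]
    intro i
    by_cases h : i ∈ B <;> cases hx : x i <;> simp [flipOn, h, hx]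

open Classical in
lemma card_accepts_flipOn_ge {m N : ℕ} (hm : 8 ≤ m) (hN : N * 256 = 2 ^ m)
    (B : Finset (Fin (m * m))) (hB : #B = m) (x : Fin (m * m) → Bool)
    (hx : |(weight x : ℝ) - (m : ℝ) ^ 2 / 2| ≤ (m : ℝ)) :
    Real.exp (-8) / 1536 * Fintype.card (Fin N → Fin m → Fin (m * m)) ≤
      #(univ.filter fun T : Fin N → Fin m → Fin (m * m) =>
        ¬ (Accepts T x ↔ Accepts T (flipOn B x))) := by
  set y := flipOn B x with hy
  have hyx : flipOn B y = x := flipOn_involutive B x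
  have hwx := weight_eq_add B x
  have hwy := weight_eq_add B y
  rw [hyx, show (fun i => y i && x i) = fun i => x i && y i from funext fun i => Bool.and_comm _ _]
    at hwy
  -- Each position of `B` is a one of exactly one of `x` and `y`, so one of them has at least m/2
  -- ones there that the other lacks.
  have huv : #(B.filter fun i => x i = true) + #(B.filter fun i => y i = true) = m := by
    refine Eq.trans ?_ hB
    rw [← card_filter_add_card_filter_not (s := B) (fun i => x i = true)]
    congr 2
    refine filter_congr fun i hi => ?_
    simp [hy, flipOn, hi]
  rw [← hy] at hwx
  set z := weight fun i => x i && y i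
  set u := #(B.filter fun i => x i = true)
  set v := #(B.filter fun i => y i = true)
  have hwx' : (weight x : ℝ) = z + u := by exact_mod_cast hwx
  have hwy' : (weight y : ℝ) = z + v := by exact_mod_cast hwy
  have huv' : (u : ℝ) + v = m := by exact_mod_cast huv
  have hu : (0 : ℝ) ≤ u := Nat.cast_nonneg _
  have hv : (0 : ℝ) ≤ v := Nat.cast_nonneg _
  rw [abs_le] at hx
  -- The flip moves the weight by at most m, so `y` stays within the wider window 2m.
  rcases le_total (m / 2 : ℝ) u with h | h
  · refine (card_accepts_not_accepts_ge hm hN x y (by linarith) (by linarith) (by linarith)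
      (show (z : ℝ) + _ ≤ _ by linarith)).trans ?_
    exact_mod_cast card_le_card (monotone_filter_right _ fun T _ hT => by tauto)
  · refine (card_accepts_not_accepts_ge hm hN y x (by linarith) (by linarith) (by linarith)
      ?_).trans ?_
    · rw [show (fun i => y i && x i) = fun i => x i && y i from
        funext fun i => Bool.and_comm _ _]
      change (z : ℝ) + _ ≤ _
      linarith
    · exact_mod_cast card_le_card (monotone_filter_right _ fun T _ hT => by tauto)

/-- Chebyshev's inequality for the number of ones. -/
lemma card_weight_near_ge {m : ℕ} (hm : 0 < m) :
    3 / 4 * (2 : ℝ) ^ (m * m) ≤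
      #(univ.filter fun x : Fin (m * m) → Bool => |(weight x : ℝ) - (m : ℝ) ^ 2 / 2| ≤ (m : ℝ)) := by
  have hm0 : (0 : ℝ) < m := by exact_mod_cast hm
  have hsum := card_filter_add_card_filter_not (s := (univ : Finset (Fin (m * m) → Bool)))
    (fun x => |(weight x : ℝ) - (m : ℝ) ^ 2 / 2| ≤ (m : ℝ))
  have hsum' : (#(univ.filter fun x : Fin (m * m) → Bool => |(weight x : ℝ) - (m : ℝ) ^ 2 / 2| ≤ (m : ℝ)) : ℝ)
      + #(univ.filter fun x : Fin (m * m) → Bool => ¬ |(weight x : ℝ) - (m : ℝ) ^ 2 / 2| ≤ (m : ℝ)) =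
      2 ^ (m * m) := by
    rw [← Nat.cast_add, hsum]
    simp
  have hvar := sum_weight_sub_sq (n := m * m)
  have hle : (m : ℝ) ^ 2 *
      #(univ.filter fun x : Fin (m * m) → Bool => ¬ |(weight x : ℝ) - (m : ℝ) ^ 2 / 2| ≤ (m : ℝ)) ≤
      2 ^ (m * m) * (m ^ 2 / 4) := by
    calc _ = ∑ x ∈ univ.filter fun x : Fin (m * m) → Bool => ¬ |(weight x : ℝ) - (m : ℝ) ^ 2 / 2| ≤ (m : ℝ),
          (m : ℝ) ^ 2 := by
          rw [sum_const, nsmul_eq_mul, mul_comm]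
      _ ≤ ∑ x ∈ univ.filter fun x : Fin (m * m) → Bool => ¬ |(weight x : ℝ) - (m : ℝ) ^ 2 / 2| ≤ (m : ℝ),
          ((weight x : ℝ) - (m : ℝ) ^ 2 / 2) ^ 2 := by
          refine sum_le_sum fun x hx => ?_
          rw [mem_filter, not_le] at hx
          rw [← sq_abs ((weight x : ℝ) - (m : ℝ) ^ 2 / 2)]
          exact pow_le_pow_left₀ hm0.le hx.2.le 2
      _ ≤ ∑ x : Fin (m * m) → Bool, ((weight x : ℝ) - (m : ℝ) ^ 2 / 2) ^ 2 :=
          sum_le_sum_of_subset_of_nonneg (filter_subset _ _) fun x _ _ => sq_nonneg _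
      _ = _ := by
          rw [Nat.cast_mul, ← sq (m : ℝ)] at hvar
          exact hvar
  have hle' : (#(univ.filter fun x : Fin (m * m) → Bool =>
      ¬ |(weight x : ℝ) - (m : ℝ) ^ 2 / 2| ≤ (m : ℝ)) : ℝ) ≤ 2 ^ (m * m) / 4 := by
    refine le_of_mul_le_mul_left (hle.trans (le_of_eq ?_)) (show (0 : ℝ) < m ^ 2 by positivity)
    ring
  linarith

open Classical in
/-- Some family of `2 ^ m / 256` terms of width `m` over `m * m` variables is sensitive to flipping
blocks of `m` variables. -/
lemma exists_sensitive_terms {m N : ℕ} (hm : 8 ≤ m) (hN : N * 256 = 2 ^ m)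
    (β : Fin (m * m) → Fin m) (hβ : ∀ j, #(block β j) = m) :
    ∃ T : Fin N → Fin m → Fin (m * m),
      m * (Real.exp (-8) / 2048 * 2 ^ (m * m)) ≤
        ∑ j, (#(univ.filter fun x : Fin (m * m) → Bool =>
          ¬ (Accepts T x ↔ Accepts T (flipOn (block β j) x))) : ℝ) := by
  have : Nonempty (Fin (m * m)) := ⟨⟨0, by positivity⟩⟩
  -- First-moment method: average over all families of terms.
  suffices h : ∑ _T : Fin N → Fin m → Fin (m * m), m * (Real.exp (-8) / 2048 * 2 ^ (m * m)) ≤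
      ∑ T : Fin N → Fin m → Fin (m * m), ∑ j, (#(univ.filter fun x : Fin (m * m) → Bool =>
          ¬ (Accepts T x ↔ Accepts T (flipOn (block β j) x))) : ℝ) by
    obtain ⟨T, -, hT⟩ := exists_le_of_sum_le univ_nonempty h
    exact ⟨T, hT⟩
  rw [sum_const, card_univ, nsmul_eq_mul, sum_comm]
  set M : ℝ := ((Fintype.card (Fin N → Fin m → Fin (m * m)) : ℕ) : ℝ) with hM
  have hj : ∀ j, M * (Real.exp (-8) / 2048 * 2 ^ (m * m)) ≤
      ∑ T : Fin N → Fin m → Fin (m * m), (#(univ.filter fun x : Fin (m * m) → Bool =>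
          ¬ (Accepts T x ↔ Accepts T (flipOn (block β j) x))) : ℝ) := by
    intro j
    have hswap : ∑ T : Fin N → Fin m → Fin (m * m), (#(univ.filter fun x : Fin (m * m) → Bool =>
          ¬ (Accepts T x ↔ Accepts T (flipOn (block β j) x))) : ℝ) =
        ∑ x : Fin (m * m) → Bool, (#(univ.filter fun T : Fin N → Fin m → Fin (m * m) =>
          ¬ (Accepts T x ↔ Accepts T (flipOn (block β j) x))) : ℝ) := by
      simp only [card_filter, Nat.cast_sum]
      exact sum_comm
    rw [hswap]
    -- 1/2048 is the Chebyshev fraction 3/4 times 1/1536.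
    calc M * (Real.exp (-8) / 2048 * 2 ^ (m * m))
        = 3 / 4 * (2 : ℝ) ^ (m * m) * (Real.exp (-8) / 1536 * M) := by ring
      _ ≤ #(univ.filter fun x : Fin (m * m) → Bool => |(weight x : ℝ) - (m : ℝ) ^ 2 / 2| ≤ (m : ℝ)) *
            (Real.exp (-8) / 1536 * M) := by
          gcongr
          exact card_weight_near_ge (by omega)
      _ = ∑ x ∈ univ.filter fun x : Fin (m * m) → Bool => |(weight x : ℝ) - (m : ℝ) ^ 2 / 2| ≤ (m : ℝ),
            (Real.exp (-8) / 1536 * M) := by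
          rw [sum_const, nsmul_eq_mul]
      _ ≤ ∑ x ∈ univ.filter fun x : Fin (m * m) → Bool => |(weight x : ℝ) - (m : ℝ) ^ 2 / 2| ≤ (m : ℝ),
            (#(univ.filter fun T : Fin N → Fin m → Fin (m * m) =>
              ¬ (Accepts T x ↔ Accepts T (flipOn (block β j) x))) : ℝ) := by
          refine sum_le_sum fun x hx => ?_
          exact card_accepts_flipOn_ge hm hN _ (hβ j) x (mem_filter.mp hx).2
      _ ≤ _ := sum_le_sum_of_subset_of_nonneg (filter_subset _ _) fun x _ _ => Nat.cast_nonneg _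
  calc M * (m * (Real.exp (-8) / 2048 * 2 ^ (m * m)))
      = ∑ _j : Fin m, M * (Real.exp (-8) / 2048 * 2 ^ (m * m)) := by
        simp
        ring
    _ ≤ _ := sum_le_sum fun j _ => hj j

/-! ### From a DNF to an XOS function -/

lemma exists_isXOS_of_clauses {n : ℕ} (C : Finset (Fin n → ℝ)) (hC : C.Nonempty)
    (hpos : ∀ w ∈ C, ∀ i, 0 ≤ w i) :
    ∃ f : (Fin n → Bool) → ℝ, IsXOS f ∧ (∀ x, ∃ w ∈ C, f x = ∑ i, w i * toReal x i) ∧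
      ∀ x, ∀ w ∈ C, ∑ i, w i * toReal x i ≤ f x := by
  have h1 : ∀ x, ∃ w ∈ C, C.sup' hC (fun w => ∑ i, w i * toReal x i) = ∑ i, w i * toReal x i :=
    fun x => exists_mem_eq_sup' hC _
  have h2 : ∀ x, ∀ w ∈ C, ∑ i, w i * toReal x i ≤ C.sup' hC (fun w => ∑ i, w i * toReal x i) :=
    fun x w hw => le_sup' (fun w => ∑ i, w i * toReal x i) hw
  refine ⟨fun x => C.sup' hC fun w => ∑ i, w i * toReal x i, ⟨C, hpos, fun x => ⟨?_, ?_⟩⟩, h1, h2⟩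
  · obtain ⟨w, hw, h⟩ := h1 x
    exact ⟨w, hw, h.symm⟩
  · rintro _ ⟨w, hw, rfl⟩
    exact h2 x w hw

/-- The weight vector of the fraction of satisfied variables of the term `h`. -/
noncomputable def termClause {n m : ℕ} (h : Fin m → Fin n) (i : Fin n) : ℝ :=
  -- Repeated variables count with multiplicity, so `h` need not be injective.
  ∑ l, if h l = i then 1 / (m : ℝ) else 0

lemma sum_termClause_mul {n m : ℕ} (h : Fin m → Fin n) (x : Fin n → Bool) :
    ∑ i, termClause h i * toReal x i = (∑ l, toReal x (h l)) / m := by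
  simp only [termClause, sum_mul, ite_mul, zero_mul]
  rw [sum_comm, sum_div]
  refine sum_congr rfl fun l _ => ?_
  rw [sum_ite_eq, if_pos (mem_univ _)]
  ring

lemma toReal_nonneg {n : ℕ} (x : Fin n → Bool) (i : Fin n) : 0 ≤ toReal x i := by
  rw [toReal]; split_ifs <;> norm_num

lemma toReal_le_one {n : ℕ} (x : Fin n → Bool) (i : Fin n) : toReal x i ≤ 1 := by
  rw [toReal]; split_ifs <;> norm_num

/-- An XOS function which is `1` where the terms `T` accept and `1 - 1 / m` elsewhere, except at
the origin. -/
lemma exists_isXOS_of_terms {n m N : ℕ} (hm : 0 < m) (hn : 0 < n) (T : Fin N → Fin m → Fin n) :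
    ∃ f : (Fin n → Bool) → ℝ, (∀ x, f x ∈ Set.Icc (0 : ℝ) 1) ∧ IsXOS f ∧
      (∀ x, Accepts T x → f x = 1) ∧ (∀ x, ¬ Accepts T x → f x ≤ 1 - 1 / m) ∧
      ∀ x i, x i = true → 1 - 1 / m ≤ f x := by
  classical
  have hm1 : (1 : ℝ) ≤ m := by exact_mod_cast hm
  have hm0 : (0 : ℝ) < m := by linarith
  have hinv : 1 / (m : ℝ) ≤ 1 := by rw [div_le_one hm0]; exact hm1
  have hinv0 : 0 ≤ 1 / (m : ℝ) := by positivity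
  -- An unsatisfied term clause is at most 1 - 1/m; the singleton clauses raise every nonzero point
  -- to that floor.
  set C : Finset (Fin n → ℝ) := univ.image (fun t => termClause (T t)) ∪
    univ.image (fun i => Pi.single i (1 - 1 / (m : ℝ))) with hC
  have hmem : ∀ w, w ∈ C ↔ (∃ t, termClause (T t) = w) ∨
      ∃ i, Pi.single i (1 - 1 / (m : ℝ)) = w := by
    intro w
    simp [hC]
  have hsingle : ∀ (x : Fin n → Bool) i, ∑ l, (Pi.single i (1 - 1 / (m : ℝ)) : Fin n → ℝ) l *
      toReal x l = (1 - 1 / m) * toReal x i := by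
    intro x i
    rw [sum_eq_single i] <;> simp +contextual
  have hterm1 : ∀ (x : Fin n → Bool) t, (∑ l, toReal x (T t l)) / m ≤ 1 := by
    intro x t
    rw [div_le_one hm0]
    calc ∑ l, toReal x (T t l) ≤ ∑ _l : Fin m, (1 : ℝ) := sum_le_sum fun l _ => toReal_le_one _ _
      _ = m := by simp
  have hpos : ∀ w ∈ C, ∀ i, 0 ≤ w i := by
    intro w hw i
    rcases (hmem w).mp hw with ⟨t, rfl⟩ | ⟨l, rfl⟩
    · exact sum_nonneg fun l _ => by split_ifs <;> positivity
    · rw [Pi.single_apply]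
      split_ifs <;> linarith
  obtain ⟨f, hf, hatt, hub⟩ := exists_isXOS_of_clauses C
    ⟨_, (hmem _).mpr (Or.inr ⟨⟨0, hn⟩, rfl⟩)⟩ hpos
  have hle1 : ∀ x, f x ≤ 1 := by
    intro x
    obtain ⟨w, hw, h⟩ := hatt x
    rw [h]
    rcases (hmem w).mp hw with ⟨t, rfl⟩ | ⟨l, rfl⟩
    · rw [sum_termClause_mul]
      exact hterm1 x t
    · rw [hsingle]
      nlinarith [toReal_le_one x l, toReal_nonneg x l]
  refine ⟨f, fun x => ⟨?_, hle1 x⟩, hf, ?_, ?_, ?_⟩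
  · obtain ⟨w, hw, h⟩ := hatt x
    rw [h]
    exact sum_nonneg fun i _ => mul_nonneg (hpos w hw i) (toReal_nonneg x i)
  · rintro x ⟨t, ht⟩
    refine le_antisymm (hle1 x) ?_
    have := hub x _ ((hmem _).mpr (Or.inl ⟨t, rfl⟩))
    rw [sum_termClause_mul] at this
    refine le_trans (le_of_eq ?_) this
    simp [toReal, ht, hm0.ne']
  · intro x hx
    obtain ⟨w, hw, h⟩ := hatt x
    rw [h]
    rcases (hmem w).mp hw with ⟨t, rfl⟩ | ⟨l, rfl⟩
    · rw [sum_termClause_mul, div_le_iff₀ hm0, show (1 - 1 / (m : ℝ)) * m = m - 1 by field_simp]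
      have hl : ∃ l, x (T t l) ≠ true := by
        by_contra! hcon
        exact hx ⟨t, hcon⟩
      obtain ⟨l, hl⟩ := hl
      calc ∑ i, toReal x (T t i) ≤ ∑ i, if i = l then (0 : ℝ) else 1 := by
            refine sum_le_sum fun i _ => ?_
            split_ifs with h
            · subst h
              simp [toReal, hl]
            · exact toReal_le_one _ _
        _ = m - 1 := by
            rw [← sum_erase_add _ _ (mem_univ l), sum_congr rfl (g := fun _ => (1 : ℝ))]
            · simp [Nat.cast_sub hm]
            · intro i hi
              simp [ne_of_mem_erase hi]
    · rw [hsingle]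
      nlinarith [toReal_le_one x l, toReal_nonneg x l]
  · intro x i hi
    have := hub x _ ((hmem _).mpr (Or.inr ⟨i, rfl⟩))
    rw [hsingle] at this
    simpa [toReal, hi] using this

/-! ### Degree lower bound from sensitivity -/

lemma sum_sq_le_of_l2Norm_le {n : ℕ} {g : (Fin n → Bool) → ℝ} {ε : ℝ} (h : l2Norm g ≤ ε) :
    ∑ x, g x ^ 2 ≤ 2 ^ n * ε ^ 2 := by
  have h1 := (Real.sqrt_le_iff.mp h).2
  rw [div_le_iff₀ (by positivity)] at h1
  linarith

/-- With `s` = 1/m, the bound on `ε` makes the error term 6mε² at most 1/24 of the left side, so the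
degree term must carry the rest. -/
lemma degree_bound_of_energy {m s δ ε d : ℝ} (hm : 0 < m) (hsm : s * m = 1) (hδ : 0 ≤ δ)
    (hδ1 : δ ≤ 1) (hε : 0 ≤ ε) (hd : 0 ≤ d) (hεs : ε ≤ δ / 12 * s)
    (h : s ^ 2 * (m * δ) ≤ 6 * m * ε ^ 2 + 12 * d * (2 * ε ^ 2 + 4 * s ^ 2)) :
    δ * m / 144 ≤ d := by
  have hs : 0 < s := by
    rw [eq_one_div_of_mul_eq_one_left hsm]
    positivity
  have hδ2 : δ ^ 2 ≤ δ := by nlinarith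
  have hε3 : ε ^ 2 ≤ δ / 144 * s ^ 2 := by
    calc ε ^ 2 ≤ (δ / 12 * s) ^ 2 := by gcongr
      _ = δ ^ 2 / 144 * s ^ 2 := by ring
      _ ≤ δ / 144 * s ^ 2 := by gcongr
  have hε4 : ε ^ 2 ≤ s ^ 2 := by nlinarith [sq_nonneg s]
  have hfin : s ^ 2 * (m * δ) ≤ s ^ 2 * (m * δ / 24 + 72 * d) := by
    calc s ^ 2 * (m * δ) ≤ 6 * m * ε ^ 2 + 12 * d * (2 * ε ^ 2 + 4 * s ^ 2) := h
      _ ≤ 6 * m * (δ / 144 * s ^ 2) + 12 * d * (2 * s ^ 2 + 4 * s ^ 2) := by gcongr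
      _ = _ := by ring
  have := le_of_mul_le_mul_left hfin (by positivity)
  have hmd : 0 ≤ m * δ := by positivity
  linarith

open Classical in
/-- If `f` stays within `1 / m` of `1 - 1 / m` off the origin and changes by `1 / m` under a
constant fraction of the block flips, then good approximants of `f` have degree of order `m`. -/
lemma le_totalDegree_of_sensitive {n m : ℕ} (hm : 0 < m) (hmn : m ^ 2 ≤ 2 ^ n)
    (β : Fin n → Fin m) (f : (Fin n → Bool) → ℝ) (A : (Fin n → Bool) → Prop)
    (hf : ∀ x, f x ∈ Set.Icc (0 : ℝ) 1)
    (hA : ∀ x, A x → f x = 1) (hA' : ∀ x, ¬ A x → f x ≤ 1 - 1 / m)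
    (hlow : ∀ x i, x i = true → 1 - 1 / m ≤ f x)
    {δ ε : ℝ} (hδ : 0 < δ) (hδ1 : δ ≤ 1) (hε : 0 < ε) (hεm : ε ≤ δ / 12 / m)
    (hsens : m * (δ * 2 ^ n) ≤
      ∑ j, (#(univ.filter fun x => ¬ (A x ↔ A (flipOn (block β j) x))) : ℝ))
    (p : MvPolynomial (Fin n) ℝ) (hp : l2Norm (fun x => f x - MvPolynomial.eval (toReal x) p) ≤ ε) :
    δ * m / 144 ≤ p.totalDegree := by
  have hm1 : (1 : ℝ) ≤ m := by exact_mod_cast hm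
  have hm0 : (0 : ℝ) < m := by linarith
  have hW : (0 : ℝ) < 2 ^ n := by positivity
  have hinv0 : 0 < 1 / (m : ℝ) := by positivity
  have hinv1 : 1 / (m : ℝ) ≤ 1 := by rw [div_le_one hm0]; exact hm1
  set W : ℝ := 2 ^ n with hWdef
  set s : ℝ := 1 / m with hs
  have hsm : s * m = 1 := by rw [hs]; field_simp
  -- The origin may deviate by as much as 1; this absorbs it into the total W s² of the other
  -- points.
  have hWs : 1 ≤ W * s ^ 2 := by
    have : ((m : ℝ)) ^ 2 ≤ W := by rw [hWdef]; exact_mod_cast hmn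
    calc (1 : ℝ) = (m : ℝ) ^ 2 * s ^ 2 := by rw [← mul_pow, mul_comm, hsm, one_pow]
      _ ≤ W * s ^ 2 := by gcongr
  set P : (Fin n → Bool) → ℝ := fun x => MvPolynomial.eval (toReal x) p with hP
  have herr : ∑ x, (f x - P x) ^ 2 ≤ W * ε ^ 2 := sum_sq_le_of_l2Norm_le hp
  -- Subtracting the constant leaves flip differences unchanged but reduces the second moment to
  -- order 1/m².
  set q : MvPolynomial (Fin n) ℝ := p - MvPolynomial.C (1 - s) with hq
  have hqdeg : q.totalDegree ≤ p.totalDegree := by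
    exact MvPolynomial.totalDegree_sub_C_le p (1 - s)
  have hqeval : ∀ x, MvPolynomial.eval (toReal x) q = P x - (1 - s) := by
    intro x
    simp [hq, hP]
  have henergy := sum_sq_sub_flipOn_le β q
  simp only [hqeval] at henergy
  have hfdev : ∑ x, (f x - (1 - s)) ^ 2 ≤ W * s ^ 2 + 1 := by
    calc ∑ x, (f x - (1 - s)) ^ 2 ≤ ∑ x, (s ^ 2 + if x = fun _ => false then (1 : ℝ) else 0) := by
          refine sum_le_sum fun x _ => ?_
          have h1 := hf x
          split_ifs with hx
          · nlinarith [h1.1, h1.2]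
          · obtain ⟨i, hi⟩ := Function.ne_iff.mp hx
            have h2 := hlow x i (by simpa using hi)
            nlinarith [h1.2]
      _ = W * s ^ 2 + 1 := by
          rw [sum_add_distrib]
          simp [hWdef]
  have hqmom : ∑ x, (P x - (1 - s)) ^ 2 ≤ W * (2 * ε ^ 2 + 4 * s ^ 2) := by
    calc ∑ x, (P x - (1 - s)) ^ 2 ≤ ∑ x, (2 * (f x - P x) ^ 2 + 2 * (f x - (1 - s)) ^ 2) := by
          refine sum_le_sum fun x _ => ?_
          nlinarith [sq_nonneg (f x - P x + (f x - (1 - s)))]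
      _ = 2 * ∑ x, (f x - P x) ^ 2 + 2 * ∑ x, (f x - (1 - s)) ^ 2 := by
          rw [sum_add_distrib, mul_sum, mul_sum]
      _ ≤ _ := by linarith
  have hlower : s ^ 2 * (m * (δ * W)) ≤ ∑ j, ∑ x, (f x - f (flipOn (block β j) x)) ^ 2 := by
    calc s ^ 2 * (m * (δ * W)) ≤ s ^ 2 * ∑ j,
          (#(univ.filter fun x => ¬ (A x ↔ A (flipOn (block β j) x))) : ℝ) := by gcongr
      _ = ∑ j, ∑ x, if ¬ (A x ↔ A (flipOn (block β j) x)) then s ^ 2 else 0 := by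
          rw [mul_sum]
          refine sum_congr rfl fun j _ => ?_
          rw [← sum_filter, sum_const, nsmul_eq_mul, mul_comm]
      _ ≤ _ := by
          refine sum_le_sum fun j _ => sum_le_sum fun x _ => ?_
          by_cases h : A x ↔ A (flipOn (block β j) x)
          · rw [if_neg (not_not_intro h)]
            exact sq_nonneg _
          · rw [if_pos h]
            by_cases hx : A x
            · have h1 := hA x hx
              have h2 := hA' _ fun hy => h ⟨fun _ => hy, fun _ => hx⟩
              rw [h1]
              nlinarith
            · have hy : A (flipOn (block β j) x) := by tauto
              have h1 := hA _ hy
              have h2 := hA' x hx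
              rw [h1]
              nlinarith
  -- Insert `P` at both endpoints and use (a+b+c)² ≤ 3(a²+b²+c²); both error terms have equal sums
  -- because the flip is a bijection.
  have hupper : ∑ j, ∑ x, (f x - f (flipOn (block β j) x)) ^ 2 ≤
      m * (6 * (W * ε ^ 2)) + 3 * ∑ j, ∑ x, (P x - P (flipOn (block β j) x)) ^ 2 := by
    have hj : ∀ j, ∑ x, (f x - f (flipOn (block β j) x)) ^ 2 ≤
        6 * (W * ε ^ 2) + 3 * ∑ x, (P x - P (flipOn (block β j) x)) ^ 2 := by
      intro j
      have hflip := sum_flipOn (block β j) fun x => (f x - P x) ^ 2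
      calc ∑ x, (f x - f (flipOn (block β j) x)) ^ 2
          ≤ ∑ x, (3 * (f x - P x) ^ 2 +
              3 * (f (flipOn (block β j) x) - P (flipOn (block β j) x)) ^ 2 +
              3 * (P x - P (flipOn (block β j) x)) ^ 2) := by
            refine sum_le_sum fun x _ => ?_
            generalize f (flipOn (block β j) x) = c
            generalize P (flipOn (block β j) x) = d
            nlinarith [sq_nonneg ((f x - P x) + (c - d)), sq_nonneg ((f x - P x) - (P x - d)),
              sq_nonneg ((c - d) + (P x - d))]
        _ = 3 * ∑ x, (f x - P x) ^ 2 + 3 * ∑ x, (f x - P x) ^ 2 +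
              3 * ∑ x, (P x - P (flipOn (block β j) x)) ^ 2 := by
            rw [sum_add_distrib, sum_add_distrib, ← mul_sum, ← mul_sum, ← mul_sum, hflip]
        _ ≤ _ := by linarith
    calc _ ≤ ∑ j, (6 * (W * ε ^ 2) + 3 * ∑ x, (P x - P (flipOn (block β j) x)) ^ 2) :=
          sum_le_sum fun j _ => hj j
      _ = _ := by
          rw [sum_add_distrib, mul_sum, sum_const, card_univ, Fintype.card_fin, nsmul_eq_mul]
  have hen : ∑ j, ∑ x, (P x - P (flipOn (block β j) x)) ^ 2 ≤
      4 * (p.totalDegree : ℝ) * (W * (2 * ε ^ 2 + 4 * s ^ 2)) := by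
    calc _ = ∑ j, ∑ x, (P x - (1 - s) - (P (flipOn (block β j) x) - (1 - s))) ^ 2 := by
          simp only [sub_sub_sub_cancel_right]
      _ ≤ 4 * (q.totalDegree : ℝ) * ∑ x, (P x - (1 - s)) ^ 2 := henergy
      _ ≤ _ := by gcongr
  refine degree_bound_of_energy hm0 hsm hδ.le hδ1 hε.le (Nat.cast_nonneg _)
    (by rw [hs, mul_one_div]; exact hεm) (le_of_mul_le_mul_left ?_ hW)
  calc W * (s ^ 2 * (m * δ)) = s ^ 2 * (m * (δ * W)) := by ring
    _ ≤ m * (6 * (W * ε ^ 2)) +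
        3 * (4 * (p.totalDegree : ℝ) * (W * (2 * ε ^ 2 + 4 * s ^ 2))) := by linarith
    _ = W * (6 * m * ε ^ 2 + 12 * p.totalDegree * (2 * ε ^ 2 + 4 * s ^ 2)) := by ring

/-! ### Choice of parameters and conclusion -/

/-- The infimum of an empty set of naturals would be 0; exact interpolation shows the set is
nonempty, so the infimum is attained. -/
lemma exists_totalDegree_eq_approxDegree {n : ℕ} {ε : ℝ} (hε : 0 ≤ ε) (f : (Fin n → Bool) → ℝ) :
    ∃ p : MvPolynomial (Fin n) ℝ, p.totalDegree ≤ approxDegree ε f ∧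
      l2Norm (fun x => f x - MvPolynomial.eval (toReal x) p) ≤ ε := by
  refine Nat.sInf_mem (s := {d : ℕ | ∃ p : MvPolynomial (Fin n) ℝ, p.totalDegree ≤ d ∧
    l2Norm (fun x => f x - MvPolynomial.eval (toReal x) p) ≤ ε}) ?_
  obtain ⟨p, hp⟩ := exists_eval_eq f
  exact ⟨p.totalDegree, p, le_rfl, by simpa [hp, l2Norm] using hε⟩

lemma exists_blocks (m : ℕ) : ∃ β : Fin (m * m) → Fin m, ∀ j, #(block β j) = m := by
  refine ⟨fun i => (finProdFinEquiv.symm i).1, fun j => ?_⟩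
  rw [block, ← card_map finProdFinEquiv.symm.toEmbedding]
  have : (univ.filter fun i : Fin (m * m) => (finProdFinEquiv.symm i).1 = j).map
      finProdFinEquiv.symm.toEmbedding = {j} ×ˢ univ := by
    ext ⟨a, b⟩
    simp only [mem_map_equiv, mem_filter, mem_univ, true_and, Equiv.symm_symm,
      Equiv.symm_apply_apply, mem_product, mem_singleton, and_true]
  rw [this]
  simp

/-- An XOS function in `m * m` variables whose `ε`-approximate degree is of order `m`. -/
lemma exists_isXOS_approxDegree_ge {m : ℕ} (hm : 8 ≤ m) {ε : ℝ} (hε : 0 < ε)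
    (hεm : ε ≤ Real.exp (-8) / 2048 / 12 / m) :
    ∃ f : (Fin (m * m) → Bool) → ℝ, (∀ x, f x ∈ Set.Icc (0 : ℝ) 1) ∧ IsXOS f ∧
      Real.exp (-8) / 2048 * m / 144 ≤ approxDegree ε f := by
  obtain ⟨β, hβ⟩ := exists_blocks m
  have hN : 2 ^ (m - 8) * 256 = 2 ^ m := by
    rw [show 256 = 2 ^ 8 by norm_num, ← pow_add, Nat.sub_add_cancel hm]
  obtain ⟨T, hT⟩ := exists_sensitive_terms hm hN β hβ
  obtain ⟨f, hf, hxos, hA, hA', hlow⟩ := exists_isXOS_of_terms (by omega) (by positivity) T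
  refine ⟨f, hf, hxos, ?_⟩
  obtain ⟨p, hpd, hp⟩ := exists_totalDegree_eq_approxDegree hε.le f
  have hexp : Real.exp (-8) ≤ 1 := Real.exp_le_one_iff.mpr (by norm_num)
  refine (le_totalDegree_of_sensitive (by omega) ?_ β f (Accepts T) hf hA hA' hlow
    (by positivity) (by linarith) hε hεm hT p hp).trans (by exact_mod_cast hpd)
  rw [sq]
  exact Nat.lt_two_pow_self.le

/-- Constants do not approximate a coordinate function within error less than `1 / 2`. -/
lemma exists_isXOS_approxDegree_pos {ε : ℝ} (hε : 0 < ε) (hε2 : ε < 1 / 2) :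
    ∃ f : (Fin 1 → Bool) → ℝ, (∀ x, f x ∈ Set.Icc (0 : ℝ) 1) ∧ IsXOS f ∧
      (1 : ℝ) ≤ approxDegree ε f := by
  refine ⟨fun x => toReal x 0, fun x => ⟨toReal_nonneg x 0, toReal_le_one x 0⟩,
    ⟨{fun _ => 1}, by simp, fun x => by simp⟩, ?_⟩
  obtain ⟨p, hpd, hp⟩ := exists_totalDegree_eq_approxDegree hε.le
    fun x : Fin 1 → Bool => toReal x 0
  rw [Nat.one_le_cast, Nat.one_le_iff_ne_zero]
  intro h0
  rw [h0, Nat.le_zero, MvPolynomial.totalDegree_eq_zero_iff_eq_C] at hpd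
  have h := sum_sq_le_of_l2Norm_le hp
  rw [hpd] at h
  generalize MvPolynomial.coeff 0 p = c at h
  simp only [MvPolynomial.eval_C] at h
  rw [← (Equiv.funUnique (Fin 1) Bool).symm.sum_comp] at h
  simp [toReal] at h
  -- For every constant c, c² + (1 - c)² ≥ 1/2 > 2ε².
  nlinarith [sq_nonneg (2 * c - 1)]

end BooleanCube

theorem mainTheorem4 :
    ∃ a b c : ℝ, 0 < a ∧ 0 < b ∧ 0 < c ∧
      ∀ ε : ℝ, 0 < ε → ε < 1 / 2 →
        ∃ k : ℕ, a / ε ^ 2 ≤ (k : ℝ) ∧ (k : ℝ) ≤ b / ε ^ 2 ∧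
          ∃ f : (Fin k → Bool) → ℝ,
            (∀ x, f x ∈ Set.Icc (0 : ℝ) 1) ∧
            BooleanCube.IsXOS f ∧
            c / ε ≤ (BooleanCube.approxDegree ε f : ℝ) := by
  set δ : ℝ := Real.exp (-8) / 2048 with hδ
  have hδ0 : 0 < δ := by positivity
  have hδ1 : δ ≤ 1 := by
    have : Real.exp (-8) ≤ 1 := Real.exp_le_one_iff.mpr (by norm_num)
    linarith
  have hδ2 : δ ^ 2 ≤ δ := by nlinarith
  -- The threshold δ/96 is where δ/(12ε) reaches 8, and 3456 = 24 · 144. Above it, k = 1 meets all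
  -- three bounds.
  refine ⟨(δ / 96) ^ 2, 1, δ ^ 2 / 3456, by positivity, one_pos, by positivity,
    fun ε hε hε2 => ?_⟩
  rcases le_or_gt ε (δ / 96) with hsmall | hlarge
  · have h8 : 8 ≤ δ / 12 / ε := by
      rw [le_div_iff₀ hε]
      linarith
    set m := ⌊δ / 12 / ε⌋₊ with hm
    have hm8 : 8 ≤ m := Nat.le_floor (by exact_mod_cast h8)
    have hmle : (m : ℝ) ≤ δ / 12 / ε := Nat.floor_le (by positivity)
    -- Rounding down a number that is at least 8 loses less than half of it.
    have hmge : δ / 24 / ε ≤ m := by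
      have h1 := Nat.lt_floor_add_one (δ / 12 / ε)
      have h2 : (8 : ℝ) ≤ m := by exact_mod_cast hm8
      have h3 : δ / 24 / ε = δ / 12 / ε / 2 := by ring
      rw [h3]
      linarith
    have hm0 : (0 : ℝ) < m := by positivity
    obtain ⟨f, hf, hxos, hdeg⟩ := BooleanCube.exists_isXOS_approxDegree_ge hm8 hε (by
      rw [le_div_iff₀ hm0, mul_comm]
      exact (le_div_iff₀ hε).mp hmle)
    refine ⟨m * m, ?_, ?_, f, hf, hxos, le_trans ?_ hdeg⟩
    · rw [← div_pow, Nat.cast_mul, ← sq]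
      refine pow_le_pow_left₀ (by positivity) (le_trans ?_ hmge) 2
      gcongr
      linarith
    · rw [Nat.cast_mul, ← sq]
      calc (m : ℝ) ^ 2 ≤ (δ / 12 / ε) ^ 2 := by gcongr
        _ ≤ (1 / ε) ^ 2 := by
            gcongr
            linarith
        _ = 1 / ε ^ 2 := by rw [div_pow, one_pow]
    · calc δ ^ 2 / 3456 / ε = δ * (δ / 24 / ε) / 144 := by ring
        _ ≤ δ * m / 144 := by gcongr
  · obtain ⟨f, hf, hxos, hdeg⟩ := BooleanCube.exists_isXOS_approxDegree_pos hε hε2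
    refine ⟨1, ?_, ?_, f, hf, hxos, le_trans ?_ hdeg⟩
    · rw [Nat.cast_one, div_le_one (by positivity)]
      gcongr
    · rw [Nat.cast_one, le_div_iff₀ (by positivity)]
      nlinarith
    · rw [div_le_one hε]
      linarith
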